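/- Let $u$ be a finite sequence (word) with $r$ distinct letters. Two sequences are isomorphic if one is obtained from the other by a one-to-one renaming of letters; a sequence $s$ avoids $u$ if no (not necessarily contiguous) subsequence of $s$ is isomorphic to $u$. A sequence is $r$-sparse if the letters of any contiguous block of at most $r$ letters are pairwise distinct, i.e. two occurrences of the same letter are at distance at least $r$. A sequence $s$ with letters in an alphabet $A$ (not all letters of $A$ need occur) is $u$-saturated if $s$ is $r$-sparse, $s$ avoids $u$, and inserting any letter of $A$ at any position of $s$ (the ends included) gives a sequence that is not $r$-sparse or does not avoid $u$. Let $\mathrm{Sat}(n,u)$ be the minimum length of a $u$-saturated sequence over an alphabet of $n$ letters. Theorem. For fixed $u$, $\mathrm{Sat}(n,u)=O(n)$ as $n\to\infty$ in each of the following cases. (1) $u=abcabc\cdots$, that is, $u$ is one of $(abc)^t$, $(abc)^ta$, $(abc)^tab$ with $t\ge 1$ and $a,b,c$ distinct letters. (2) $u=aa\dots bb$, that is, $u$ has the form $aa\,v\,bb$ with letters $a,b$ (possibly equal) and an arbitrary, possibly empty, sequence $v$, and $u$ cannot be written as a concatenation $u=u_1u_2$ of two nonempty sequences with no letters in common. (3)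 $u=abc\dots xyz$ is a sequence in exactly three letters, with $a,b,c$ distinct, $xyz\in\{abc,bca,cab\}$ and $f_0(u)\ge f_1(u)+5$, where $f_0(u)$ is the number of pairs of consecutive letters of $u$ of the form $ab$, $bc$ or $ca$, and $f_1(u)$ is the number of pairs of consecutive letters of $u$ of the form $ac$, $ba$ or $cb$. -/

import Mathlib

namespace SeqSat

/-- The number `r` of distinct letters of `u`. -/
def numLetters {α : Type*} [DecidableEq α] (u : List α) : ℕ := u.toFinset.card

/-- `v` is isomorphic to `u`: it is obtained from `u` by a one-to-one renaming of the letters. -/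
def Isomorphic {α β : Type*} (u : List α) (v : List β) : Prop :=
  ∃ f : α → β, Set.InjOn f {x | x ∈ u} ∧ v = u.map f

/-- `s` avoids `u`: no (not necessarily contiguous) subsequence of `s` is isomorphic to `u`. -/
def Avoids {α β : Type*} (s : List β) (u : List α) : Prop :=
  ∀ v : List β, v.Sublist s → ¬ Isomorphic u v

/-- `s` is `r`-sparse: the letters of every contiguous block of at most `r` letters of `s` are
pairwise distinct, i.e. two occurrences of the same letter are at distance at least `r`.
(Blocks shorter than `r` matter only when `s` itself has fewer than `r` letters.) -/
def IsSparse {β : Type*} (r : ℕ) (s : List β) : Prop :=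
  ∀ v : List β, v <:+: s → v.length ≤ r → v.Nodup

/-- The sequence `s` over the alphabet `β` is `u`-saturated. Letters of `β` need not all occur
in `s`, and a letter may be inserted at any position, the two ends included. -/
def IsSaturated {α β : Type*} [DecidableEq α] (u : List α) (s : List β) : Prop :=
  IsSparse (numLetters u) s ∧ Avoids s u ∧
    ∀ (p q : List β) (x : β), s = p ++ q →
      ¬ IsSparse (numLetters u) (p ++ x :: q) ∨ ¬ Avoids (p ++ x :: q) u

/-- The saturation function `Sat(n, u)`: the minimum length of a `u`-saturated sequence over an
alphabet of `n` letters (it would be `⊤` if there were no such sequence). -/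
noncomputable def Sat {α : Type*} [DecidableEq α] (n : ℕ) (u : List α) : ℕ∞ :=
  ⨅ (s : List (Fin n)) (_ : IsSaturated u s), (s.length : ℕ∞)

/-- `Sat(n, u) = O(n)` as `n → ∞`, for fixed `u`. -/
def SatLinear {α : Type*} [DecidableEq α] (u : List α) : Prop :=
  ∃ C N : ℕ, ∀ n : ℕ, N ≤ n → Sat n u ≤ ((C * n : ℕ) : ℕ∞)

/-- The concatenation `w ^ t` of `t` copies of `w`. -/
def power {α : Type*} (w : List α) (t : ℕ) : List α := (List.replicate t w).flatten

/-- `u = abcabc…`, i.e. `u` is `(abc)^t`, `(abc)^t a` or `(abc)^t ab` with `t ≥ 1` and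
`a, b, c` distinct. -/
def IsAlternation {α : Type*} (u : List α) : Prop :=
  ∃ (a b c : α) (t : ℕ), a ≠ b ∧ b ≠ c ∧ a ≠ c ∧ 1 ≤ t ∧
    (u = power [a, b, c] t ∨ u = power [a, b, c] t ++ [a] ∨ u = power [a, b, c] t ++ [a, b])

/-- `u = aa…bb` (the letters `a` and `b` may coincide). -/
def IsDoubleEnded {α : Type*} (u : List α) : Prop :=
  ∃ (a b : α) (v : List α), u = [a, a] ++ v ++ [b, b]

/-- `u` is irreducible: it is not a concatenation `u₁ u₂` of two nonempty sequences without a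
common letter. -/
def Irreducible {α : Type*} (u : List α) : Prop :=
  ¬ ∃ u₁ u₂ : List α, u₁ ≠ [] ∧ u₂ ≠ [] ∧ u = u₁ ++ u₂ ∧ List.Disjoint u₁ u₂

/-- The number of positions `i` such that the pair `(u i, u (i+1))` of consecutive letters of `u`
is one of the pairs in the list `P`. -/
def countPairs {α : Type*} [DecidableEq α] (P : List (α × α)) (u : List α) : ℕ :=
  (u.zip u.tail).countP (fun p => decide (p ∈ P))

/-- `f₀(u)`, the number of consecutive pairs of the form `ab`, `bc`, `ca`. -/
def f0 {α : Type*} [DecidableEq α] (a b c : α) (u : List α) : ℕ :=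
  countPairs [(a, b), (b, c), (c, a)] u

/-- `f₁(u)`, the number of consecutive pairs of the form `ac`, `ba`, `cb`. -/
def f1 {α : Type*} [DecidableEq α] (a b c : α) (u : List α) : ℕ :=
  countPairs [(a, c), (b, a), (c, b)] u

/-- `u = abc…xyz` is a sequence in exactly three letters `a, b, c`, with
`xyz ∈ {abc, bca, cab}` and `f₀(u) ≥ f₁(u) + 5`. -/
def IsForwardThreeLetter {α : Type*} [DecidableEq α] (u : List α) : Prop :=
  ∃ (a b c : α) (v w : List α), a ≠ b ∧ b ≠ c ∧ a ≠ c ∧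
    u = [a, b, c] ++ v ++ w ∧
    (w = [a, b, c] ∨ w = [b, c, a] ∨ w = [c, a, b]) ∧
    (∀ x ∈ v, x = a ∨ x = b ∨ x = c) ∧
    f1 a b c u + 5 ≤ f0 a b c u

end SeqSat

/-! All cases rest on `satLinear_of_bounded_gaps`. Take a sparse `u`-avoiding sequence `s` of length
`O(n)` in which, at every position, only boundedly many letters can be inserted without creating
`u`. Extend `s` greedily to a saturated `S`. The part of `S` inside one gap of `s` uses only those
few letters, and sparse `u`-avoiding sequences over a bounded alphabet have bounded length
(`length_lt_of_avoids`), so `S` is still of length `O(n)`.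

For `u = aa…bb`, let `L` be such that the cyclic word `0 1 … (r-1) 0 1 …` avoids `u` at length `L`
but not at length `L + 1`. The doubled ends make the added letter flexible: any of the `r` letters,
put before or after the word of length `L`, creates `u`. Concatenate such words over disjoint blocks
of letters; irreducibility keeps `u` from straddling blocks. A letter from a block can then be
inserted, at most, inside its own block.

For three letters, let `d + 3` be the length of the shortest word `abcabc…` reached by embedding `u`
greedily. The sequence `weave d` has period three except that the letter of one residue class is
renewed at each multiple of `d`. Each renewal begins or ends a periodic stretch of `d + 2` letters,
and a letter inserted far from its run prolongs such a stretch to `d + 3`, which creates `u`.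
Conversely `weave d` avoids `u` (`weave_occurrence_false`): all three letters occur at both ends of
`u`, so their runs must overlap, and the overlap is too short for `u` read forwards by the choice of
`d`, and read backwards because `f0` exceeds `f1` by at least four. Alternations of length at least
five are of this kind; only `abc` and `abca` remain. -/

namespace SeqSat

/-! ### Avoidance and sparsity under renaming -/

variable {α β γ : Type*}

theorem avoids_iff {s : List β} {u : List α} :
    Avoids s u ↔ ∀ f : α → β, Set.InjOn f {x | x ∈ u} → ¬ (u.map f).Sublist s := by
  constructor
  · intro h f hf hs
    exact h _ hs ⟨f, hf, rfl⟩
  · rintro h v hv ⟨f, hf, rfl⟩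
    exact h f hf hv

theorem Avoids.mono {s t : List β} {u : List α} (h : Avoids t u) (hs : s.Sublist t) :
    Avoids s u :=
  fun v hv => h v (hv.trans hs)

theorem IsSparse.of_infix {r : ℕ} {s t : List β} (h : IsSparse r t) (hs : s <:+: t) :
    IsSparse r s :=
  fun v hv => h v (hv.trans hs)

theorem avoids_nil {u : List α} (hu : u ≠ []) : Avoids ([] : List β) u := by
  rw [avoids_iff]
  intro f _ h
  exact hu (List.map_eq_nil_iff.1 (List.sublist_nil.1 h))

theorem isSparse_nil (r : ℕ) : IsSparse r ([] : List β) := by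
  intro v hv _
  rw [List.infix_nil.1 hv]
  exact List.nodup_nil

theorem avoids_map_iff {g : β → γ} (hg : Function.Injective g) {s : List β} {u : List α}
    (hu : u ≠ []) : Avoids (s.map g) u ↔ Avoids s u := by
  rw [avoids_iff, avoids_iff]
  constructor
  · intro h f hf hs
    refine h (g ∘ f) (hg.comp_injOn hf) ?_
    rw [← List.map_map]
    exact hs.map g
  · intro h f hf hs
    obtain ⟨l, hl, hlu⟩ := List.sublist_map_iff.1 hs
    obtain ⟨x, hx⟩ := List.exists_mem_of_ne_nil u hu
    -- An isomorphism is a map on all of `α`, so a left inverse of `g` is needed everywhere; this is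
    -- where `u ≠ []` matters.
    have hne : Nonempty β := by
      rcases l with _ | ⟨y, l⟩
      · simp [hu] at hlu
      · exact ⟨y⟩
    have key : ∀ x ∈ u, g (Function.invFun g (f x)) = f x := by
      intro x hx
      have : f x ∈ l.map g := hlu ▸ List.mem_map_of_mem hx
      obtain ⟨y, -, hy⟩ := List.mem_map.1 this
      exact Function.invFun_eq ⟨y, hy⟩
    refine h (Function.invFun g ∘ f) ?_ ?_
    · intro x hx y hy hxy
      apply hf hx hy
      rw [← key x hx, ← key y hy]
      exact congrArg g hxy
    · have : u.map (Function.invFun g ∘ f) = l := by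
        apply List.map_injective_iff.2 hg
        rw [← hlu, List.map_map]
        exact List.map_congr_left key
      rwa [this]

theorem isSparse_map_iff {g : β → γ} (hg : Function.Injective g) {r : ℕ} {s : List β} :
    IsSparse r (s.map g) ↔ IsSparse r s := by
  constructor
  · intro h v hv hr
    have := h (v.map g) (hv.map g) (by simpa using hr)
    exact (List.nodup_map_iff hg).1 this
  · intro h v hv hr
    obtain ⟨l, hl, rfl⟩ := List.infix_map_iff.1 hv
    exact (List.nodup_map_iff hg).2 (h l hl (by simpa using hr))

/-! ### Length bounds and the reduction to bounded gaps -/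

/-- The `i`-th letter is taken from the `i`-th copy of `b`. -/
theorem map_sublist_flatten_replicate {f : α → β} {b : List β} (l : List α)
    (h : ∀ x ∈ l, f x ∈ b) : (l.map f).Sublist (List.replicate l.length b).flatten := by
  induction l with
  | nil => simp
  | cons x l ih =>
    rw [List.map_cons, List.length_cons, List.replicate_succ, List.flatten_cons]
    exact (List.singleton_sublist.2 (h x (by simp))).append
      (ih fun y hy => h y (List.mem_cons_of_mem _ hy))

theorem exists_blocks (r M : ℕ) (w : List β) (h : r * M ≤ w.length) :
    ∃ ws : List (List β), ws.length = M ∧ ws.flatten.Sublist w ∧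
      ∀ b ∈ ws, b.length = r ∧ b <:+: w := by
  induction M generalizing w with
  | zero => exact ⟨[], rfl, by simp, by simp⟩
  | succ M ih =>
    rw [Nat.mul_succ] at h
    obtain ⟨ws, h1, h2, h3⟩ := ih (w.drop r) (by rw [List.length_drop]; omega)
    refine ⟨w.take r :: ws, by simp [h1], ?_, ?_⟩
    · rw [List.flatten_cons]
      conv_rhs => rw [← List.take_append_drop r w]
      exact (List.Sublist.refl _).append h2
    · intro b hb
      rcases List.mem_cons.1 hb with rfl | hb
      · exact ⟨by rw [List.length_take]; omega, (List.take_prefix _ _).isInfix⟩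
      · exact ⟨(h3 b hb).1, (h3 b hb).2.trans (List.drop_suffix _ _).isInfix⟩

/-- An embedding of `s` cuts `S` into `s.length + 1` intervals, and any single letter of an interval
can be added to `s` at that gap within `S`. -/
theorem length_le_of_gaps {C : ℕ} {s S : List β} (h : s.Sublist S)
    (hC : ∀ w : List β, w <:+: S →
      (∃ p q, s = p ++ q ∧ ∀ x ∈ w, (p ++ x :: q).Sublist S) → w.length ≤ C) :
    S.length ≤ s.length + (s.length + 1) * C := by
  induction s generalizing S with
  | nil =>
    have := hC S List.infix_rfl ⟨[], [], rfl, fun x hx => List.singleton_sublist.2 hx⟩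
    simpa using this
  | cons y s ih =>
    obtain ⟨R, T, rfl, hy, hT⟩ := List.cons_sublist_iff.1 h
    obtain ⟨R₁, R₂, rfl⟩ := List.append_of_mem hy
    have hyT : (y :: s).Sublist (y :: R₂ ++ T) :=
      (hT.trans (List.sublist_append_right _ _)).cons_cons y
    have h1 := hC R₁ ⟨[], y :: R₂ ++ T, by simp⟩ ⟨[], y :: s, rfl, fun x hx => by
      rw [List.append_assoc]
      exact (List.singleton_sublist.2 hx).append hyT⟩
    have h2 := ih (S := R₂ ++ T) (hT.trans (List.sublist_append_right _ _)) (by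
      rintro w hw ⟨p, q, rfl, hpq⟩
      refine hC w (hw.trans ⟨R₁ ++ [y], [], by simp⟩) ⟨y :: p, q, rfl, fun x hx => ?_⟩
      rw [List.append_assoc]
      exact (((hpq x hx).cons_cons y)).trans (List.sublist_append_right _ _))
    simp only [List.length_append, List.length_cons] at h2 ⊢
    nlinarith

variable [DecidableEq α]

/-- A sparse `u`-avoiding sequence over a fixed set of letters has bounded length. -/
theorem length_lt_of_avoids {u : List α} (hu : u ≠ []) {w : List β} {T : Finset β}
    (hT : ∀ x ∈ w, x ∈ T) (hs : IsSparse (numLetters u) w) (ha : Avoids w u) :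
    w.length < numLetters u * (T.card ^ numLetters u * u.length + 1) := by
  classical
  by_contra! hlt
  set r := numLetters u with hr
  obtain ⟨ws, h1, h2, h3⟩ := exists_blocks r _ w hlt
  -- Blocks are functions `Fin r → T`, so there are at most `T.card ^ r` of them and some block
  -- recurs `u.length` times. Its `r` letters are distinct by sparsity, so its repetitions contain a
  -- copy of `u`.
  have hsub : ws.toFinset ⊆ (Fintype.piFinset fun _ : Fin r => T).image List.ofFn := by
    intro b hb
    rw [List.mem_toFinset] at hb
    obtain ⟨hbl, hbw⟩ := h3 b hb
    rw [Finset.mem_image]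
    refine ⟨fun i => b[i.1]'(hbl.symm ▸ i.2), ?_, ?_⟩
    · rw [Fintype.mem_piFinset]
      intro i
      exact hT _ (hbw.subset (List.getElem_mem _))
    · apply List.ext_getElem
      · simp [hbl]
      · intro i _ _
        simp
  have hcard : ws.toFinset.card ≤ T.card ^ r := by
    refine (Finset.card_le_card hsub).trans (Finset.card_image_le.trans ?_)
    simp
  obtain ⟨b, hb, hbc⟩ : ∃ b ∈ ws.toFinset, u.length ≤ ws.count b := by
    by_contra! hcon
    have : ws.length ≤ ws.toFinset.card * u.length := by
      rw [← List.sum_toFinset_count_eq_length, ← smul_eq_mul]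
      exact Finset.sum_le_card_nsmul _ _ _ fun b hb => by
        convert (hcon b hb).le
    have := this.trans (Nat.mul_le_mul_right _ hcard)
    omega
  rw [List.mem_toFinset] at hb
  obtain ⟨hbl, hbw⟩ := h3 b hb
  have hnd : b.Nodup := hs b hbw hbl.le
  obtain ⟨x, hx⟩ := List.exists_mem_of_ne_nil u hu
  have hrpos : 0 < r := Finset.card_pos.2 ⟨x, List.mem_toFinset.2 hx⟩
  have : Nonempty β := ⟨b[0]'(hbl.symm ▸ hrpos)⟩
  obtain ⟨f, hf1, hf2⟩ := u.toFinset.finite_toSet.exists_injOn_of_encard_le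
    (t := (b.toFinset : Set β)) (by
      rw [Set.encard_coe_eq_coe_finsetCard, Set.encard_coe_eq_coe_finsetCard,
        List.toFinset_card_of_nodup hnd, hbl, hr, numLetters])
  refine avoids_iff.1 ha f (fun x hx y hy => hf2 (by simpa using hx) (by simpa using hy)) ?_
  refine (map_sublist_flatten_replicate u (b := b) ?_).trans (List.Sublist.trans ?_ h2)
  · intro x hx
    simpa using hf1 (show x ∈ (u.toFinset : Set α) by simpa using hx)
  · exact List.Sublist.flatten (List.replicate_sublist_iff.2 hbc)

/-- A sparse `u`-avoiding sequence over a finite alphabet extends to a `u`-saturated one. -/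
theorem exists_isSaturated_of_avoids [Fintype β] {u : List α} (hu : u ≠ []) (s : List β)
    (hs : IsSparse (numLetters u) s) (ha : Avoids s u) :
    ∃ S : List β, s.Sublist S ∧ IsSaturated u S := by
  classical
  induction hk : numLetters u * (Fintype.card β ^ numLetters u * u.length + 1) - s.length
    using Nat.strong_induction_on generalizing s with
  | _ k ih =>
    have hlt := length_lt_of_avoids hu (T := Finset.univ) (fun x _ => Finset.mem_univ x) hs ha
    rw [Finset.card_univ] at hlt
    by_cases hsat : IsSaturated u s
    · exact ⟨s, List.Sublist.refl _, hsat⟩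
    · have : ∃ (p q : List β) (x : β), s = p ++ q ∧ IsSparse (numLetters u) (p ++ x :: q) ∧
          Avoids (p ++ x :: q) u := by
        by_contra! hcon
        refine hsat ⟨hs, ha, fun p q x h => ?_⟩
        by_cases h' : IsSparse (numLetters u) (p ++ x :: q)
        · exact Or.inr (hcon p q x h h')
        · exact Or.inl h'
      obtain ⟨p, q, x, rfl, h1, h2⟩ := this
      obtain ⟨S, hS, hS'⟩ := ih _ (by simp only [List.length_append, List.length_cons] at hk hlt ⊢; omega)
        (p ++ x :: q) h1 h2 rfl
      exact ⟨S, (List.Sublist.append_left (List.sublist_cons_self x q) p).trans hS, hS'⟩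

theorem Sat_le {n : ℕ} {u : List α} {S : List (Fin n)} (h : IsSaturated u S) :
    Sat n u ≤ (S.length : ℕ∞) :=
  iInf₂_le S h

/-- If some sparse `u`-avoiding sequences of linear length admit only boundedly many letters at
each gap, then `Sat n u` is linear. -/
theorem satLinear_of_bounded_gaps {u : List α} (hu : u ≠ []) (A K N : ℕ)
    (H : ∀ n, N ≤ n → ∃ s : List ℕ, (∀ x ∈ s, x < n) ∧ IsSparse (numLetters u) s ∧ Avoids s u ∧
      s.length ≤ A * n ∧ ∀ p q, s = p ++ q → ∃ T : Finset ℕ, T.card ≤ K ∧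
        ∀ x < n, Avoids (p ++ x :: q) u → x ∈ T) : SatLinear u := by
  classical
  set C := numLetters u * (K ^ numLetters u * u.length + 1) with hC
  -- There are at most `A * n + 1 ≤ (A + 1) * n` gaps, each of length at most `C`; `N + 1` ensures
  -- `1 ≤ n`.
  refine ⟨A + (A + 1) * C, N + 1, fun n hn => ?_⟩
  obtain ⟨s, hsn, hsp, hav, hlen, hgap⟩ := H n (by omega)
  obtain ⟨s, rfl⟩ : ∃ s' : List (Fin n), s'.map Fin.val = s :=
    ⟨s.pmap (fun x hx => ⟨x, hx⟩) hsn, by simp [List.map_pmap]⟩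
  rw [isSparse_map_iff Fin.val_injective] at hsp
  rw [avoids_map_iff Fin.val_injective hu] at hav
  rw [List.length_map] at hlen
  obtain ⟨S, hsS, hS⟩ := exists_isSaturated_of_avoids hu s hsp hav
  refine (Sat_le hS).trans ?_
  have hb : S.length ≤ s.length + (s.length + 1) * C := by
    refine length_le_of_gaps hsS ?_
    rintro w hw ⟨p, q, rfl, hpq⟩
    obtain ⟨T, hTK, hT⟩ := hgap (p.map Fin.val) (q.map Fin.val) (by simp)
    have hwT : ∀ x ∈ w, x ∈ T.preimage Fin.val Fin.val_injective.injOn := by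
      intro x hx
      rw [Finset.mem_preimage]
      refine hT x x.2 ?_
      have : p.map Fin.val ++ x.1 :: q.map Fin.val = (p ++ x :: q).map Fin.val := by simp
      rw [this, avoids_map_iff Fin.val_injective hu]
      exact hS.2.1.mono (hpq x hx)
    have hcard : (T.preimage (Fin.val : Fin n → ℕ) Fin.val_injective.injOn).card ≤ K := by
      refine le_trans ?_ hTK
      exact Finset.card_le_card_of_injOn Fin.val (fun x hx => by simpa using hx)
        Fin.val_injective.injOn
    refine (length_lt_of_avoids hu hwT (hS.1.of_infix hw) (hS.2.1.mono hw.sublist)).le.trans ?_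
    rw [hC]
    gcongr
  have : S.length ≤ (A + (A + 1) * C) * n := by
    refine hb.trans ?_
    have h1 : 1 ≤ n := by omega
    have h2 : s.length + 1 ≤ (A + 1) * n := by nlinarith
    calc s.length + (s.length + 1) * C ≤ A * n + ((A + 1) * n) * C := by gcongr
      _ = (A + (A + 1) * C) * n := by ring
  exact_mod_cast this

/-- If every sparse `u`-avoiding sequence has linear length, then `Sat n u` is linear. -/
theorem satLinear_of_length_le {u : List α} (hu : u ≠ [])
    (H : ∀ n (s : List (Fin n)), IsSparse (numLetters u) s → Avoids s u → s.length ≤ n) :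
    SatLinear u := by
  refine ⟨1, 0, fun n _ => ?_⟩
  obtain ⟨S, -, hS⟩ := exists_isSaturated_of_avoids (β := Fin n) hu [] (isSparse_nil _)
    (avoids_nil hu)
  refine (Sat_le hS).trans ?_
  have := H n S hS.1 hS.2.1
  rw [one_mul]
  exact_mod_cast this

/-! ### Cyclic words and concatenation over disjoint alphabets -/

theorem sublist_of_pairwise_lt {P Q : List ℕ} (hP : P.Pairwise (· < ·)) (hQ : Q.Pairwise (· < ·))
    (h : P ⊆ Q) : P.Sublist Q :=
  List.sublist_of_subperm_of_pairwise (List.subperm_of_subset (hP.imp fun h => h.ne) h) hP hQ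

theorem sublist_range {P : List ℕ} {N : ℕ} (hP : P.Pairwise (· < ·)) (h : ∀ p ∈ P, p < N) :
    P.Sublist (List.range N) :=
  sublist_of_pairwise_lt hP List.pairwise_lt_range fun p hp => List.mem_range.2 (h p hp)

/-- The word `0 1 … (r-1) 0 1 …` of length `L`. -/
def cyclicWord (r L : ℕ) : List ℕ := (List.range L).map (· % r)

theorem isSparse_map_range {β : Type*} {r N : ℕ} {F : ℕ → β}
    (hF : ∀ p q, p < q → q < p + r → F p ≠ F q) :
    IsSparse r ((List.range N).map F) := by
  intro v hv hr
  obtain ⟨l, ⟨s, t, hst⟩, rfl⟩ := List.infix_map_iff.1 hv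
  rw [List.length_map] at hr
  have hl : l = List.range' s.length l.length := by
    rw [List.append_assoc, List.range_eq_range'] at hst
    obtain ⟨k, hk, rfl, h⟩ := List.range'_eq_append_iff.1 hst.symm
    obtain ⟨m, hm, h', -⟩ := List.range'_eq_append_iff.1 h.symm
    rw [h']
    simp
  rw [hl]
  apply List.Nodup.map_on
  · intro p hp q hq hpq
    rw [List.mem_range'_1] at hp hq
    by_contra hne
    rcases lt_or_gt_of_ne hne with h | h
    · exact hF p q h (by omega) hpq
    · exact hF q p h (by omega) hpq.symm
  · exact List.nodup_range'

/-- An occurrence straddling the seam would split `u` into two nonempty parts with no common letter.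
-/
theorem Avoids.append {α β : Type*} {A B : List β} {u : List α} (hA : Avoids A u)
    (hB : Avoids B u) (hu : Irreducible u) (hd : List.Disjoint A B) : Avoids (A ++ B) u := by
  rw [avoids_iff]
  intro f hf h
  obtain ⟨l₁, l₂, h12, h1, h2⟩ := List.sublist_append_iff.1 h
  obtain ⟨u₁, u₂, rfl, rfl, rfl⟩ := List.map_eq_append_iff.1 h12
  by_cases hu1 : u₁ = []
  · subst hu1
    exact avoids_iff.1 hB f hf h2
  by_cases hu2 : u₂ = []
  · subst hu2
    exact avoids_iff.1 hA f hf (by simpa using h1)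
  refine hu ⟨u₁, u₂, hu1, hu2, rfl, fun x hx1 hx2 => ?_⟩
  exact hd (h1.subset (List.mem_map_of_mem hx1)) (h2.subset (List.mem_map_of_mem hx2))

theorem IsSparse.append {β : Type*} {A B : List β} {r : ℕ} (hA : IsSparse r A)
    (hB : IsSparse r B) (hd : List.Disjoint A B) : IsSparse r (A ++ B) := by
  intro v hv hr
  rcases List.infix_append_iff.1 hv with h | h | ⟨a, b, rfl, ha, hb⟩
  · exact hA v h hr
  · exact hB v h hr
  · rw [List.length_append] at hr
    rw [List.nodup_append']
    exact ⟨hA a ha.isInfix (by omega), hB b hb.isInfix (by omega),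
      fun x hx1 hx2 => hd (ha.subset hx1) (hb.subset hx2)⟩


theorem mod_ne_mod_of_lt {r p q : ℕ} (h : p < q) (h' : q < p + r) : p % r ≠ q % r := by
  intro heq
  have h1 := (Nat.modEq_iff_dvd' h.le).1 (show p ≡ q [MOD r] from heq)
  have h2 := Nat.le_of_dvd (by omega) h1
  omega

theorem add_mod_injOn (r c : ℕ) : Set.InjOn (fun y => (y + c) % r) {y | y < r} := by
  intro x hx y hy hxy
  have h : x ≡ y [MOD r] := Nat.ModEq.add_right_cancel' c (show x + c ≡ y + c [MOD r] from hxy)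
  exact h.eq_of_lt_of_lt hx hy

theorem exists_add_mod_eq {r c : ℕ} (hc : c < r) (p : ℕ) : ∃ e < r, (p + e) % r = c := by
  refine ⟨(c + (r - p % r)) % r, Nat.mod_lt _ (by omega), ?_⟩
  have hp : p % r < r := Nat.mod_lt _ (by omega)
  rw [Nat.add_mod_mod, ← Nat.mod_add_mod, show p % r + (c + (r - p % r)) = c + r by omega, Nat.add_mod_right,
    Nat.mod_eq_of_lt hc]

theorem isSparse_cyclicWord (r L : ℕ) : IsSparse r (cyclicWord r L) :=
  isSparse_map_range fun _ _ => mod_ne_mod_of_lt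

/-! ### Irreducible words with doubled ends -/

section

variable {α : Type*}

theorem exists_cyclicWord_critical [DecidableEq α] {u : List α} (hu : u ≠ []) :
    ∃ L, Avoids (cyclicWord (numLetters u) L) u ∧
      ¬ Avoids (cyclicWord (numLetters u) (L + 1)) u := by
  classical
  by_contra! hcon
  have hall : ∀ L, Avoids (cyclicWord (numLetters u) L) u := by
    intro L
    induction L with
    | zero => exact avoids_nil hu
    | succ L ih => exact hcon L ih
  have hr : 0 < numLetters u := by
    obtain ⟨x, hx⟩ := List.exists_mem_of_ne_nil u hu
    exact Finset.card_pos.2 ⟨x, List.mem_toFinset.2 hx⟩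
  have := length_lt_of_avoids hu (T := Finset.range (numLetters u))
    (w := cyclicWord (numLetters u)
      (numLetters u * ((Finset.range (numLetters u)).card ^ numLetters u * u.length + 1)))
    (fun x hx => by
      obtain ⟨p, -, rfl⟩ := List.mem_map.1 hx
      exact Finset.mem_range.2 (Nat.mod_lt _ hr)) (isSparse_cyclicWord _ _) (hall _)
  simp [cyclicWord] at this

theorem exists_positions {N r : ℕ} {u : List α} (h : ¬ Avoids (cyclicWord r N) u) :
    ∃ f : α → ℕ, Set.InjOn f {x | x ∈ u} ∧ ∃ P : List ℕ, P.Pairwise (· < ·) ∧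
      (∀ p ∈ P, p < N) ∧ u.map f = P.map (· % r) := by
  rw [avoids_iff] at h
  push Not at h
  obtain ⟨f, hf, hs⟩ := h
  obtain ⟨P, hP, hPu⟩ := List.sublist_map_iff.1 hs
  exact ⟨f, hf, P, List.pairwise_lt_range.sublist hP,
    fun p hp => List.mem_range.1 (hP.subset hp), hPu⟩

theorem add_le_of_mod_eq {r p q : ℕ} (h : p < q) (h' : p % r = q % r) : p + r ≤ q := by
  by_contra! hlt
  exact mod_ne_mod_of_lt h hlt h'

/-- The two leading `a`s lie at least `r` apart, so without the first one the occurrence can move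
left by `r - e` for any `e < r`. A suitable `e` turns the second `a` into `c`, and the prepended `c`
replaces the first. -/
theorem not_avoids_cons_cyclicWord {r L c : ℕ} {a : α} {v : List α} (hc : c < r)
    (h : ¬ Avoids (cyclicWord r (L + 1)) (a :: a :: v)) :
    ¬ Avoids (c :: cyclicWord r L) (a :: a :: v) := by
  obtain ⟨f, hf, P, hP, hPN, hPu⟩ := exists_positions h
  rcases P with _ | ⟨p₀, _ | ⟨p₁, P⟩⟩
  · simp at hPu
  · simp at hPu
  simp only [List.map_cons, List.cons.injEq] at hPu
  obtain ⟨h0, h1, hv⟩ := hPu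
  obtain ⟨e, her, hec⟩ := exists_add_mod_eq hc p₁
  rw [List.pairwise_cons] at hP
  have hp01 : p₀ + r ≤ p₁ := add_le_of_mod_eq (hP.1 p₁ (by simp)) (h0 ▸ h1)
  have hge : ∀ p ∈ p₁ :: P, r ≤ p := by
    intro p hp
    rcases List.mem_cons.1 hp with rfl | hp
    · omega
    · have := (List.pairwise_cons.1 hP.2).1 p hp
      omega
  have hfr : ∀ x ∈ a :: a :: v, f x < r := by
    intro x hx
    have : f x ∈ (p₀ :: p₁ :: P).map (· % r) := by
      rw [List.map_cons, List.map_cons, ← h0, ← h1, ← hv, ← List.map_cons, ← List.map_cons]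
      exact List.mem_map_of_mem hx
    obtain ⟨p, -, hp⟩ := List.mem_map.1 this
    rw [← hp]
    exact Nat.mod_lt _ (by omega)
  have hshift : ∀ p ∈ p₁ :: P, (p - r + e) % r = (p % r + e) % r := by
    intro p hp
    rw [Nat.mod_add_mod, ← Nat.add_mod_right (p - r + e), show p - r + e + r = p + e by
      have := hge p hp; omega]
  have hmap : (a :: v).map (fun x => (f x + e) % r) =
      ((p₁ :: P).map (fun p => p - r + e)).map (· % r) := by
    have : (a :: v).map f = (p₁ :: P).map (· % r) := by simp [h1, hv]
    rw [List.map_map, List.map_congr_left (f := (· % r) ∘ fun p => p - r + e)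
      (g := fun p => (p % r + e) % r) hshift]
    change (a :: v).map ((fun y => (y + e) % r) ∘ f) =
      (p₁ :: P).map ((fun y => (y + e) % r) ∘ (· % r))
    rw [← List.map_map, ← List.map_map, this]
  rw [avoids_iff]
  push Not
  refine ⟨fun x => (f x + e) % r, ?_, ?_⟩
  · exact (add_mod_injOn r e).comp hf fun x hx => hfr x hx
  · rw [List.map_cons, hmap, h1, Nat.mod_add_mod, hec]
    refine List.Sublist.cons_cons _ (List.Sublist.map _ (sublist_range ?_ ?_))
    · rw [List.pairwise_map]
      refine hP.2.imp_of_mem fun {p q} hp hq hpq => ?_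
      have := hge p hp
      omega
    · intro p hp
      obtain ⟨p, hp', rfl⟩ := List.mem_map.1 hp
      have := hPN p (List.mem_cons_of_mem _ hp')
      have := hge p hp'
      omega

/-- Mirror image: without the last `b`, the occurrence has room to move right by any `e < r`. -/
theorem not_avoids_cyclicWord_append {r L c : ℕ} {b : α} {v : List α} (hc : c < r)
    (h : ¬ Avoids (cyclicWord r (L + 1)) (v ++ [b, b])) :
    ¬ Avoids (cyclicWord r L ++ [c]) (v ++ [b, b]) := by
  obtain ⟨f, hf, P, hP, hPN, hPu⟩ := exists_positions h
  rw [List.map_append] at hPu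
  obtain ⟨P, P', rfl, hv, hb⟩ := List.map_eq_append_iff.1 hPu.symm
  obtain ⟨p₀, p₁, rfl⟩ : ∃ p₀ p₁, P' = [p₀, p₁] :=
    List.length_eq_two.1 (by simpa using congrArg List.length hb)
  simp only [List.map_cons, List.map_nil, List.cons.injEq, and_true] at hb
  obtain ⟨h0, h1⟩ := hb
  obtain ⟨e, her, hec⟩ := exists_add_mod_eq hc p₀
  rw [show P ++ [p₀, p₁] = (P ++ [p₀]) ++ [p₁] by simp] at hP hPN
  rw [List.pairwise_append] at hP
  have hp01 : p₀ + r ≤ p₁ := add_le_of_mod_eq (hP.2.2 p₀ (by simp) p₁ (by simp)) (by rw [h0, h1])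
  have hp1 := hPN p₁ (by simp)
  have hle : ∀ p ∈ P ++ [p₀], p ≤ p₀ := by
    intro p hp
    rcases List.mem_append.1 hp with hp | hp
    · exact ((List.pairwise_append.1 hP.1).2.2 p hp p₀ (by simp)).le
    · rw [List.mem_singleton.1 hp]
  have hfr : ∀ x ∈ v ++ [b, b], f x < r := by
    intro x hx
    have : f x ∈ (P ++ [p₀, p₁]).map (· % r) := by
      rw [← hPu, ← List.map_append]
      exact List.mem_map_of_mem hx
    obtain ⟨p, -, hp⟩ := List.mem_map.1 this
    rw [← hp]
    exact Nat.mod_lt _ (by omega)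
  have hmap : (v ++ [b]).map (fun x => (f x + e) % r) =
      ((P ++ [p₀]).map (fun p => p + e)).map (· % r) := by
    have : (v ++ [b]).map f = (P ++ [p₀]).map (· % r) := by simp [hv, h0]
    rw [List.map_map, List.map_congr_left (l := P ++ [p₀]) (g := fun p => (p % r + e) % r)
      (fun p _ => by simp)]
    change (v ++ [b]).map ((fun y => (y + e) % r) ∘ f) =
      (P ++ [p₀]).map ((fun y => (y + e) % r) ∘ (· % r))
    rw [← List.map_map, ← List.map_map, this]
  rw [avoids_iff]
  push Not
  refine ⟨fun x => (f x + e) % r, ?_, ?_⟩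
  · exact (add_mod_injOn r e).comp hf fun x hx => hfr x hx
  · rw [show v ++ [b, b] = (v ++ [b]) ++ [b] by simp, List.map_append, hmap, List.map_singleton,
      ← h0, Nat.mod_add_mod, hec]
    refine List.Sublist.append (List.Sublist.map _ (sublist_range ?_ ?_)) (List.Sublist.refl _)
    · rw [List.pairwise_map]
      exact hP.1.imp fun h => by omega
    · intro p hp
      obtain ⟨p, hp', rfl⟩ := List.mem_map.1 hp
      have := hle p hp'
      omega

/-- The cyclic word of length `L` over the `i`-th block of `r` letters. -/
def cyclicBlock (r L i : ℕ) : List ℕ := (cyclicWord r L).map (i * r + ·)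

/-- The concatenation of cyclic words over `Q` consecutive disjoint blocks of `r` letters. -/
def cyclicBlocks (r L Q : ℕ) : List ℕ := ((List.range Q).map (cyclicBlock r L)).flatten

theorem cyclicBlocks_succ (r L Q : ℕ) :
    cyclicBlocks r L (Q + 1) = cyclicBlocks r L Q ++ cyclicBlock r L Q := by
  simp [cyclicBlocks, List.range_succ]

theorem length_cyclicBlock (r L i : ℕ) : (cyclicBlock r L i).length = L := by
  simp [cyclicBlock, cyclicWord]

theorem length_cyclicBlocks (r L Q : ℕ) : (cyclicBlocks r L Q).length = Q * L := by
  induction Q with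
  | zero => simp [cyclicBlocks]
  | succ Q ih => rw [cyclicBlocks_succ, List.length_append, ih, length_cyclicBlock, Nat.succ_mul]

theorem mem_cyclicBlock {r L i x : ℕ} (hr : 0 < r) (hx : x ∈ cyclicBlock r L i) :
    i * r ≤ x ∧ x < (i + 1) * r := by
  obtain ⟨y, hy, rfl⟩ := List.mem_map.1 hx
  obtain ⟨p, -, rfl⟩ := List.mem_map.1 hy
  have := Nat.mod_lt p hr
  rw [Nat.succ_mul]
  omega

theorem mem_cyclicBlocks {r L Q x : ℕ} (hr : 0 < r) (hx : x ∈ cyclicBlocks r L Q) :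
    x < Q * r := by
  obtain ⟨l, hl, hx⟩ := List.mem_flatten.1 hx
  obtain ⟨i, hi, rfl⟩ := List.mem_map.1 hl
  exact (mem_cyclicBlock hr hx).2.trans_le (Nat.mul_le_mul_right _ (List.mem_range.1 hi))

theorem disjoint_cyclicBlocks {r L Q : ℕ} (hr : 0 < r) :
    List.Disjoint (cyclicBlocks r L Q) (cyclicBlock r L Q) := fun _ h1 h2 =>
  absurd (mem_cyclicBlocks hr h1) (mem_cyclicBlock hr h2).1.not_gt

theorem isSparse_cyclicBlocks {r : ℕ} (hr : 0 < r) (L Q : ℕ) :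
    IsSparse r (cyclicBlocks r L Q) := by
  induction Q with
  | zero => exact isSparse_nil r
  | succ Q ih =>
    rw [cyclicBlocks_succ]
    exact ih.append ((isSparse_map_iff (add_right_injective _)).2 (isSparse_cyclicWord r L))
      (disjoint_cyclicBlocks hr)

theorem avoids_cyclicBlocks {r L : ℕ} (hr : 0 < r) {u : List α} (hu : u ≠ [])
    (hirr : Irreducible u) (h : Avoids (cyclicWord r L) u) (Q : ℕ) :
    Avoids (cyclicBlocks r L Q) u := by
  induction Q with
  | zero => exact avoids_nil hu
  | succ Q ih =>
    rw [cyclicBlocks_succ]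
    exact ih.append ((avoids_map_iff (add_right_injective _) hu).2 h) hirr
      (disjoint_cyclicBlocks hr)

theorem cyclicBlocks_eq_append {r L Q i : ℕ} (hi : i < Q) :
    ∃ B, cyclicBlocks r L Q = cyclicBlocks r L i ++ cyclicBlock r L i ++ B := by
  induction Q, hi using Nat.le_induction with
  | base => exact ⟨[], by rw [cyclicBlocks_succ, List.append_nil]⟩
  | succ Q _ ih =>
    obtain ⟨B, hB⟩ := ih
    exact ⟨B ++ cyclicBlock r L Q, by rw [cyclicBlocks_succ, hB]; simp⟩

theorem satLinear_of_isDoubleEnded [DecidableEq α] {u : List α} (hd : IsDoubleEnded u)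
    (hirr : Irreducible u) : SatLinear u := by
  obtain ⟨a, b, v, huv⟩ := hd
  have hu : u ≠ [] := by simp [huv]
  have hr : 0 < numLetters u := Finset.card_pos.2 ⟨a, by simp [huv]⟩
  obtain ⟨L, hL, hL'⟩ := exists_cyclicWord_critical hu
  set r := numLetters u with hrdef
  have hleft : ∀ c < r, ¬ Avoids (c :: cyclicWord r L) u := by
    intro c hc
    have : u = a :: a :: (v ++ [b, b]) := by simp [huv]
    rw [this] at hL' ⊢
    exact not_avoids_cons_cyclicWord hc hL'
  have hright : ∀ c < r, ¬ Avoids (cyclicWord r L ++ [c]) u := by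
    intro c hc
    rw [huv] at hL' ⊢
    exact not_avoids_cyclicWord_append hc hL'
  refine satLinear_of_bounded_gaps hu L (2 * r) 0 fun n _ =>
    ⟨cyclicBlocks r L (n / r), fun x hx => (mem_cyclicBlocks hr hx).trans_le (Nat.div_mul_le_self n r),
      isSparse_cyclicBlocks hr L _, avoids_cyclicBlocks hr hu hirr hL _, ?_, ?_⟩
  · rw [length_cyclicBlocks, mul_comm L]
    exact Nat.mul_le_mul_right _ (Nat.div_le_self n r)
  · intro p q hpq
    -- The exceptional letters: those of the block cut by the gap, and the fewer than `r` letters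
    -- left over by the complete blocks.
    refine ⟨Finset.Ico (p.length / L * r) (p.length / L * r + r) ∪
      Finset.Ico (n / r * r) (n / r * r + r), ?_, ?_⟩
    · refine (Finset.card_union_le _ _).trans ?_
      simp
      omega
    · intro x hx hav
      have hlt : x < n / r * r + r := by
        have := Nat.div_add_mod' n r
        have := Nat.mod_lt n hr
        omega
      rw [Finset.mem_union, Finset.mem_Ico, Finset.mem_Ico]
      by_contra! hcon
      have hxQ : x < n / r * r := by
        by_contra! h
        exact (hcon.2 h).not_gt hlt
      have hiQ : x / r < n / r := (Nat.div_lt_iff_lt_mul hr).2 hxQ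
      obtain ⟨B, hB⟩ := cyclicBlocks_eq_append (r := r) (L := L) hiQ
      have hxr : x / r * r + x % r = x := Nat.div_add_mod' x r
      have hmod := Nat.mod_lt x hr
      rw [hpq] at hB
      have hlen := length_cyclicBlocks r L (x / r)
      have hlen' := length_cyclicBlock r L (x / r)
      rcases le_or_gt p.length (x / r * L) with hp | hp
      · have hq : q = (cyclicBlocks r L (x / r)).drop p.length ++ cyclicBlock r L (x / r) ++ B := by
          have := congrArg (List.drop p.length) hB
          rwa [List.drop_left, List.append_assoc, List.drop_append_of_le_length (by omega),
            ← List.append_assoc] at this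
        refine hleft _ hmod ((avoids_map_iff (add_right_injective (x / r * r)) hu).1
          (hav.mono ?_))
        rw [List.map_cons, hxr, hq]
        refine (List.Sublist.cons_cons x ?_).trans (List.sublist_append_right _ _)
        exact (List.sublist_append_right _ _).trans (List.sublist_append_left _ _)
      rcases le_or_gt (x / r * L + L) p.length with hp' | hp'
      · have hq : (cyclicBlocks r L (x / r) ++ cyclicBlock r L (x / r)) <+: p := by
          refine List.prefix_of_prefix_length_le (l₃ := p ++ q) ?_ (List.prefix_append _ _) ?_
          · rw [hB]
            exact List.prefix_append _ _
          · rw [List.length_append]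
            omega
        refine hright _ hmod ((avoids_map_iff (add_right_injective (x / r * r)) hu).1
          (hav.mono ?_))
        rw [List.map_append, List.map_singleton, hxr]
        exact ((List.sublist_append_right _ _).trans hq.sublist).append
          (List.singleton_sublist.2 (by simp))
      · have : p.length / L = x / r :=
          Nat.div_eq_of_lt_le hp.le (by rw [Nat.succ_mul]; exact hp')
        rw [this] at hcon
        have := hcon.1 (by omega)
        omega

end

/-! ### The woven sequence and its runs -/

/-- The start of the run of equal letters, at distance `3` from each other, through `p`: a new
run starts at every multiple of `d`. -/
def origin (d p : ℕ) : ℕ :=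
  if h : d ∣ p ∨ p < 3 then p else origin d (p - 3)
termination_by p
decreasing_by omega

theorem origin_of_start {d p : ℕ} (h : d ∣ p ∨ p < 3) : origin d p = p := by
  rw [origin, dif_pos h]

theorem origin_sub_three {d p : ℕ} (h : ¬ d ∣ p) (h3 : 3 ≤ p) :
    origin d p = origin d (p - 3) := by
  rw [origin, dif_neg (by simp [h]; omega)]

theorem origin_spec (d p : ℕ) :
    origin d p ≤ p ∧ origin d p % 3 = p % 3 ∧ (d ∣ origin d p ∨ origin d p < 3) := by
  induction p using Nat.strong_induction_on with
  | _ p ih =>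
    by_cases h : d ∣ p ∨ p < 3
    · rw [origin_of_start h]
      exact ⟨le_rfl, rfl, h⟩
    · push Not at h
      rw [origin_sub_three h.1 h.2]
      obtain ⟨h1, h2, h3⟩ := ih (p - 3) (by omega)
      exact ⟨by omega, by omega, h3⟩

/-- Stepping back from `p` by threes cannot jump over `v`, and it stops at multiples of `d`. -/
theorem le_origin {d v p : ℕ} (hd : d ∣ v) (hmod : v % 3 = p % 3) (hv : v ≤ p) :
    v ≤ origin d p := by
  induction p using Nat.strong_induction_on with
  | _ p ih =>
    by_cases h : d ∣ p ∨ p < 3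
    · rwa [origin_of_start h]
    · push Not at h
      rw [origin_sub_three h.1 h.2]
      have : v ≠ p := fun hvp => h.1 (hvp ▸ hd)
      exact ih (p - 3) (by omega) (by omega) (by omega)

/-- The letter that marks a run with a given start. -/
def label (d v : ℕ) : ℕ := if v < 3 then v else v / d + 2

theorem label_injOn {d : ℕ} (hd : 0 < d) : Set.InjOn (label d) {v | d ∣ v ∨ v < 3} := by
  intro v hv w hw h
  have key : ∀ z, d ∣ z ∨ z < 3 → 3 ≤ z → d ∣ z ∧ 1 ≤ z / d := by
    intro z hz h3
    have hdz : d ∣ z := hz.resolve_right (by omega)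
    exact ⟨hdz, (Nat.one_le_div_iff hd).2 (Nat.le_of_dvd (by omega) hdz)⟩
  unfold label at h
  split_ifs at h with h1 h2 h2
  · exact h
  · have := (key w hw (by omega)).2
    omega
  · have := (key v hv (by omega)).2
    omega
  · obtain ⟨hv1, -⟩ := key v hv (by omega)
    obtain ⟨hw1, -⟩ := key w hw (by omega)
    rw [← Nat.div_mul_cancel hv1, ← Nat.div_mul_cancel hw1, show v / d = w / d by omega]

/-- An infinite sequence in which every three consecutive letters are distinct, the three current
letters repeat cyclically, and one of them is replaced by a new letter after every `d` steps. -/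
def weave (d p : ℕ) : ℕ := label d (origin d p)

theorem weave_eq_iff {d : ℕ} (hd : 0 < d) {p q : ℕ} :
    weave d p = weave d q ↔ origin d p = origin d q :=
  (label_injOn hd).eq_iff (origin_spec d p).2.2 (origin_spec d q).2.2

theorem mod_three_eq_of_weave_eq {d : ℕ} (hd : 0 < d) {p q : ℕ} (h : weave d p = weave d q) :
    p % 3 = q % 3 := by
  have := (origin_spec d p).2.1
  have := (origin_spec d q).2.1
  have := (weave_eq_iff hd).1 h
  omega

theorem weave_add_three {d p : ℕ} (h : ¬ d ∣ p + 3) : weave d (p + 3) = weave d p := by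
  rw [weave, origin_sub_three h (by omega), Nat.add_sub_cancel, weave]

theorem isSparse_weave {d : ℕ} (hd : 0 < d) (N : ℕ) :
    IsSparse 3 ((List.range N).map (weave d)) :=
  isSparse_map_range fun _ _ h1 h2 h => mod_ne_mod_of_lt h1 h2 (mod_three_eq_of_weave_eq hd h)

theorem weave_lt {d m p : ℕ} (hd : 0 < d) (hp : p < m * d) : weave d p < m + 2 := by
  have h1 := (origin_spec d p).1
  have h2 : origin d p / d < m := (Nat.div_lt_iff_lt_mul hd).2 (by omega)
  unfold weave label
  rcases Nat.eq_zero_or_pos m with rfl | hm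
  · simp at hp
  · split_ifs <;> omega

/-- A stretch in which no new letter starts is periodic. -/
theorem weave_add_eq {d : ℕ} {v : ℕ} (hv : d ∣ v + 2) {j : ℕ} (hj : j < d + 2) :
    weave d (v + j) = weave d (v + j % 3) := by
  induction j using Nat.strong_induction_on with
  | _ j ih =>
    by_cases h3 : j < 3
    · rw [Nat.mod_eq_of_lt h3]
    · obtain ⟨k, rfl⟩ : ∃ k, j = k + 3 := ⟨j - 3, by omega⟩
      rw [← Nat.add_assoc, weave_add_three, ih k (by omega) (by omega), Nat.add_mod_right]
      intro hdvd
      rw [show v + k + 3 = v + 2 + (k + 1) by ring, Nat.dvd_add_right hv] at hdvd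
      have := Nat.le_of_dvd (by omega) hdvd
      omega

/-- The run ends just before the next multiple `e` of `d` in its class modulo `3`, and `v + 3 * d`
is such a multiple. -/
theorem exists_run_end {d v : ℕ} (hd : 0 < d) (hv : d ∣ v) (hv3 : 3 ≤ v) :
    ∃ e, d ∣ e ∧ v + 3 ≤ e ∧ e ≤ v + 3 * d ∧ weave d (e - 3) = weave d v := by
  have hex : ∃ t, 0 < t ∧ d ∣ v + 3 * t := ⟨d, hd, hv.add (Dvd.intro_left 3 rfl)⟩
  classical
  obtain ⟨h1, h2⟩ := Nat.find_spec hex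
  have hle : Nat.find hex ≤ d := Nat.find_min' hex ⟨hd, hv.add (Dvd.intro_left 3 rfl)⟩
  have hmin : ∀ t < Nat.find hex, weave d (v + 3 * t) = weave d v := by
    intro t
    induction t with
    | zero => simp
    | succ t ih =>
      intro ht
      rw [← ih (by omega), mul_add, mul_one, ← Nat.add_assoc]
      refine weave_add_three fun hdvd => Nat.find_min hex ht ⟨by omega, ?_⟩
      rwa [mul_add, mul_one, ← Nat.add_assoc]
  refine ⟨_, h2, by omega, by omega, ?_⟩
  rw [show v + 3 * Nat.find hex - 3 = v + 3 * (Nat.find hex - 1) by omega]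
  exact hmin _ (by omega)

/-! ### Insertions into the woven sequence -/

section

variable {α : Type*}

/-- All words with period three and `d + 3` letters contain `u`. -/
def InPeriodic (d : ℕ) (u : List α) : Prop :=
  ∀ H : ℕ → ℕ, Set.InjOn H {j | j < 3} →
    ¬ Avoids ((List.range (d + 3)).map fun j => H (j % 3)) u

theorem weave_injOn {d : ℕ} (hd : 0 < d) (v c : ℕ) :
    Set.InjOn (fun j => weave d (v + (j + c) % 3)) {j | j < 3} := by
  intro i hi j hj h
  have := mod_three_eq_of_weave_eq hd h
  simp only [Set.mem_ofPred_eq] at hi hj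
  omega

theorem map_sublist_drop {β : Type*} {F : ℕ → β} {N k v l : ℕ} (hk : k ≤ v) (hN : v + l ≤ N) :
    ((List.range l).map fun j => F (v + j)).Sublist (((List.range N).map F).drop k) := by
  rw [← List.map_drop, show (fun j => F (v + j)) = F ∘ (v + ·) from rfl, ← List.map_map]
  refine List.Sublist.map _ (sublist_of_pairwise_lt ?_ ?_ ?_)
  · rw [List.pairwise_map]
    exact List.pairwise_lt_range.imp fun h => by omega
  · exact List.pairwise_lt_range.sublist (List.drop_sublist _ _)
  · intro x hx
    obtain ⟨j, hj, rfl⟩ := List.mem_map.1 hx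
    rw [List.mem_range] at hj
    rw [List.mem_iff_getElem]
    exact ⟨v + j - k, by simp; omega, by simp; omega⟩

theorem map_sublist_take {β : Type*} {F : ℕ → β} {N k v l : ℕ} (hk : v + l ≤ k) (hN : k ≤ N) :
    ((List.range l).map fun j => F (v + j)).Sublist (((List.range N).map F).take k) := by
  rw [← List.map_take, show (fun j => F (v + j)) = F ∘ (v + ·) from rfl, ← List.map_map,
    List.take_range, min_eq_left hN]
  refine List.Sublist.map _ (sublist_range ?_ ?_)
  · rw [List.pairwise_map]
    exact List.pairwise_lt_range.imp fun h => by omega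
  · intro x hx
    obtain ⟨j, hj, rfl⟩ := List.mem_map.1 hx
    rw [List.mem_range] at hj
    omega

theorem satLinear_of_avoids_weave [DecidableEq α] {u : List α} (hu : u ≠ [])
    (hr : numLetters u = 3) {d : ℕ} (hd : 2 ≤ d) (hper : InPeriodic d u)
    (hav : ∀ N, Avoids ((List.range N).map (weave d)) u) : SatLinear u := by
  have hd0 : 0 < d := by omega
  refine satLinear_of_bounded_gaps hu d 8 2 fun n hn => ?_
  obtain ⟨m, rfl⟩ : ∃ m, n = m + 2 := ⟨n - 2, by omega⟩
  refine ⟨(List.range (m * d)).map (weave d), ?_, ?_, hav _, ?_, ?_⟩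
  · intro x hx
    obtain ⟨p, hp, rfl⟩ := List.mem_map.1 hx
    exact weave_lt hd0 (List.mem_range.1 hp)
  · rw [hr]
    exact isSparse_weave hd0 _
  · rw [List.length_map, List.length_range, mul_comm]
    gcongr
    omega
  · intro p q hpq
    set k := p.length with hk
    have hkN : k ≤ m * d := by
      have := congrArg List.length hpq
      simp at this
      omega
    have hp : p = ((List.range (m * d)).map (weave d)).take k := by rw [hpq, List.take_left]
    have hq : q = ((List.range (m * d)).map (weave d)).drop k := by rw [hpq, List.drop_left]
    -- The run of `i + 2` starts at `i * d`. The exceptions are the initial letters and those whose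
    -- run may start too near the gap or be unfinished there.
    refine ⟨Finset.range 4 ∪ Finset.Ico (k / d) (k / d + 4), ?_, ?_⟩
    · exact (Finset.card_union_le _ _).trans (by simp)
    · intro x hx hxav
      by_contra hxT
      simp only [Finset.mem_union, Finset.mem_range, Finset.mem_Ico, not_or, not_lt, not_and] at hxT
      obtain ⟨hx4, hxT⟩ := hxT
      obtain ⟨i, rfl⟩ : ∃ i, x = i + 2 := ⟨x - 2, by omega⟩
      have hi4 : 4 ≤ i * d := by nlinarith
      have him : i * d + d ≤ m * d := by
        rw [← Nat.succ_mul]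
        exact Nat.mul_le_mul_right _ (by omega)
      have hwx : weave d (i * d) = i + 2 := by
        rw [weave, origin_of_start (Or.inl (Dvd.intro_left i rfl)), label, if_neg (by omega),
          Nat.mul_div_cancel _ hd0]
      have hkd := Nat.div_add_mod' k d
      have hkm := Nat.mod_lt k hd0
      rcases le_or_gt (k / d) (i + 2) with hle | hgt
      · have hik := hxT hle
        have h1 : (k / d + 2) * d ≤ i * d := Nat.mul_le_mul_right _ (by omega)
        have hki : k ≤ i * d - 2 := by
          rw [add_mul] at h1
          omega
        -- Insertion before the run: the `d + 2` positions from `i * d - 2` on are periodic with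
        -- third letter `i + 2`, so an `i + 2` in front prolongs the period.
        refine hper (fun j => weave d (i * d - 2 + (j + 2) % 3)) (weave_injOn hd0 _ _)
          (hxav.mono ?_)
        have hdv : d ∣ i * d - 2 + 2 := by
          rw [Nat.sub_add_cancel (by omega)]
          exact Dvd.intro_left i rfl
        have heq : (List.range (d + 3)).map (fun j => weave d (i * d - 2 + (j % 3 + 2) % 3)) =
            (i + 2) :: (List.range (d + 2)).map fun j => weave d (i * d - 2 + j) := by
          rw [List.range_succ_eq_map, List.map_cons, List.map_map]
          congr 1
          · rw [← hwx]
            congr 1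
            omega
          · refine List.map_congr_left fun j hj => ?_
            rw [weave_add_eq hdv (List.mem_range.1 hj)]
            simp only [Function.comp]
            congr 2
            omega
        rw [heq, hq]
        exact ((map_sublist_drop hki (by omega)).cons_cons _).trans (List.sublist_append_right _ _)
      · obtain ⟨e, hde, hve, hev, hwe⟩ := exists_run_end hd0 (Dvd.intro_left i rfl : d ∣ i * d)
          (by omega)
        have h1 : (i + 3) * d ≤ k / d * d := Nat.mul_le_mul_right _ (by omega)
        rw [add_mul] at h1
        have hek : e ≤ k := by omega
        have hed : i * d ≤ e - d := by
          obtain ⟨j, rfl⟩ := hde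
          have : i < j := by nlinarith
          have : d * j = (j - 1) * d + d := by
            rw [← Nat.succ_mul, mul_comm]
            congr 1
            omega
          rw [this, Nat.add_sub_cancel]
          exact Nat.mul_le_mul_right _ (by omega)
        -- Insertion after the run: the `d + 2` positions before `e` are periodic, and `i + 2`, the
        -- letter at `e - 3`, is what the period would put at `e`.
        refine hper (fun j => weave d (e - d - 2 + (j + 0) % 3)) (weave_injOn hd0 _ _)
          (hxav.mono ?_)
        have hdv : d ∣ e - d - 2 + 2 := by
          rw [Nat.sub_add_cancel (by omega)]
          exact Nat.dvd_sub hde dvd_rfl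
        have heq : (List.range (d + 3)).map (fun j => weave d (e - d - 2 + (j % 3 + 0) % 3)) =
            ((List.range (d + 2)).map fun j => weave d (e - d - 2 + j)) ++ [i + 2] := by
          rw [List.range_succ, List.map_append, List.map_singleton]
          congr 1
          · refine List.map_congr_left fun j hj => ?_
            rw [weave_add_eq hdv (List.mem_range.1 hj), add_zero, Nat.mod_mod]
          · rw [← hwx, ← hwe, show e - 3 = e - d - 2 + (d - 1) by omega,
              weave_add_eq hdv (j := d - 1) (by omega), show ((d + 2) % 3 + 0) % 3 = (d - 1) % 3 by omega]
        rw [heq, hp]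
        exact (map_sublist_take (by omega) hkN).append (List.singleton_sublist.2 (by simp))

end

/-! ### Weights of consecutive pairs, and avoidance by the woven sequence -/

theorem sum_map_zip_tail {α : Type*} (g : α × α → ℕ) (x : α) (u : List α) :
    ((u.zip u.tail).map g).sum =
      ∑ i ∈ Finset.range (u.length - 1), g (u.getD i x, u.getD (i + 1) x) := by
  induction u with
  | nil => simp
  | cons y l ih =>
    cases l with
    | nil => simp
    | cons z l =>
      simp only [List.tail_cons, List.zip_cons_cons, List.map_cons, List.sum_cons,
        List.length_cons, Nat.add_sub_cancel] at ih ⊢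
      rw [Finset.sum_range_succ', ih]
      exact add_comm _ _

section

variable {α : Type*} [DecidableEq α]

/-- The weight of a pair of consecutive letters: `w₀` for `ab`, `bc`, `ca`, `w₁` for `ac`, `ba`,
`cb` and `3` otherwise. -/
def pairWeight (a b c : α) (w₀ w₁ : ℕ) (e : α × α) : ℕ :=
  if e ∈ [(a, b), (b, c), (c, a)] then w₀ else if e ∈ [(a, c), (b, a), (c, b)] then w₁ else 3

/-- The total weight of the first `j` pairs of consecutive letters of `U`. -/
def weightSum (a b c : α) (w₀ w₁ : ℕ) (U : ℕ → α) (j : ℕ) : ℕ :=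
  ∑ i ∈ Finset.range j, pairWeight a b c w₀ w₁ (U i, U (i + 1))

theorem weightSum_succ (a b c : α) (w₀ w₁ : ℕ) (U : ℕ → α) (j : ℕ) :
    weightSum a b c w₀ w₁ U (j + 1) =
      weightSum a b c w₀ w₁ U j + pairWeight a b c w₀ w₁ (U j, U (j + 1)) :=
  Finset.sum_range_succ _ _

theorem weightSum_mono (a b c : α) (w₀ w₁ : ℕ) (U : ℕ → α) :
    Monotone (weightSum a b c w₀ w₁ U) :=
  monotone_nat_of_le_succ fun j => by rw [weightSum_succ]; exact Nat.le_add_right _ _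

theorem weightSum_two {a b c : α} {w₀ w₁ : ℕ} {U : ℕ → α} (h0 : U 0 = a) (h1 : U 1 = b)
    (h2 : U 2 = c) : weightSum a b c w₀ w₁ U 2 = 2 * w₀ := by
  simp [weightSum, Finset.sum_range_succ, pairWeight, h0, h1, h2, two_mul]

/-- The triple `x, y, z` is a rotation of `a, b, c`. -/
def IsRotation (a b c x y z : α) : Prop :=
  (x = a ∧ y = b ∧ z = c) ∨ (x = b ∧ y = c ∧ z = a) ∨ (x = c ∧ y = a ∧ z = b)

theorem weightSum_add_two {a b c : α} {w₀ w₁ : ℕ} {U : ℕ → α} {j : ℕ}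
    (h : IsRotation a b c (U j) (U (j + 1)) (U (j + 2))) :
    weightSum a b c w₀ w₁ U (j + 2) = weightSum a b c w₀ w₁ U j + 2 * w₀ := by
  rw [weightSum_succ, weightSum_succ]
  rcases h with ⟨h1, h2, h3⟩ | ⟨h1, h2, h3⟩ | ⟨h1, h2, h3⟩ <;>
    simp [pairWeight, h1, h2, h3, two_mul, add_assoc]

/-- Pair weights are the least distances between such letters in `abcabc…` (weights `1, 2`) or in
its reversal (`2, 1`). The two totals differ by `f0 - f1`, which is how the hypothesis on `u`
enters. -/
theorem sum_pairWeight_add {a b c : α} (hab : a ≠ b) (hbc : b ≠ c) (hac : a ≠ c)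
    (l : List (α × α)) :
    (l.map (pairWeight a b c 2 1)).sum +
        l.countP (fun p => decide (p ∈ [(a, c), (b, a), (c, b)])) =
      (l.map (pairWeight a b c 1 2)).sum +
        l.countP (fun p => decide (p ∈ [(a, b), (b, c), (c, a)])) := by
  induction l with
  | nil => rfl
  | cons e l ih =>
    have : pairWeight a b c 2 1 e + (if e ∈ [(a, c), (b, a), (c, b)] then 1 else 0) =
        pairWeight a b c 1 2 e + (if e ∈ [(a, b), (b, c), (c, a)] then 1 else 0) := by
      unfold pairWeight
      split_ifs with h1 h2
      · exfalso
        simp only [List.mem_cons, List.not_mem_nil, or_false] at h1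
        rcases h1 with rfl | rfl | rfl <;>
          simp [hab, hbc, hac, hab.symm, hbc.symm, hac.symm] at h2
      all_goals rfl
    simp only [List.map_cons, List.sum_cons, List.countP_cons, decide_eq_true_eq]
    omega

theorem countP_le_sum_pairWeight (a b c : α) (l : List (α × α)) :
    l.countP (fun p => decide (p ∈ [(a, b), (b, c), (c, a)])) ≤
      (l.map (pairWeight a b c 1 2)).sum := by
  induction l with
  | nil => rfl
  | cons e l ih =>
    have : (if e ∈ [(a, b), (b, c), (c, a)] then 1 else 0) ≤ pairWeight a b c 1 2 e := by
      unfold pairWeight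
      split_ifs <;> omega
    simp only [List.map_cons, List.sum_cons, List.countP_cons, decide_eq_true_eq]
    omega

theorem add_weightSum_le {a b c : α} {w₀ w₁ L : ℕ} {U : ℕ → α} {X : ℕ → ℕ}
    (h : ∀ j, j + 1 < L → X j + pairWeight a b c w₀ w₁ (U j, U (j + 1)) ≤ X (j + 1)) {i j : ℕ}
    (hij : i ≤ j) (hj : j < L) :
    X i + weightSum a b c w₀ w₁ U j ≤ X j + weightSum a b c w₀ w₁ U i := by
  induction j, hij using Nat.le_induction with
  | base => exact le_rfl
  | succ j hij ih =>
    have := ih (by omega)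
    have := h j hj
    rw [weightSum_succ]
    omega

/-- An occurrence in `weave d` of a word on three letters that begins with `abc` and ends with a
rotation of `abc` is short in both orientations. -/
theorem weave_occurrence_false {a b c : α} (hab : a ≠ b) (hbc : b ≠ c) (hac : a ≠ c) {d L : ℕ}
    (hd : 0 < d) (hL : 5 ≤ L) {U : ℕ → α} {X : ℕ → ℕ} {f : α → ℕ}
    (hU : ∀ j < L, U j = a ∨ U j = b ∨ U j = c) (hf : Set.InjOn f {a, b, c})
    (hX : ∀ i j, i < j → j < L → X i < X j) (hfX : ∀ j < L, f (U j) = weave d (X j))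
    (h0 : U 0 = a) (h1 : U 1 = b) (h2 : U 2 = c)
    (hlast : IsRotation a b c (U (L - 3)) (U (L - 2)) (U (L - 1)))
    (hfwd : weightSum a b c 1 2 U (L - 1) = d + 2)
    (hbwd : d + 6 ≤ weightSum a b c 2 1 U (L - 1)) : False := by
  have hUmem : ∀ j < L, U j ∈ ({a, b, c} : Set α) := fun j hj => by simpa using hU j hj
  have hO : ∀ i < L, ∀ j < L, U i = U j ↔ origin d (X i) = origin d (X j) := by
    intro i hi j hj
    rw [← weave_eq_iff hd, ← hfX i hi, ← hfX j hj, hf.eq_iff (hUmem i hi) (hUmem j hj)]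
  have hmod : ∀ j, origin d (X j) % 3 = X j % 3 := fun j => (origin_spec d (X j)).2.1
  have hre : ∀ k ≤ 2, ∃ j < L, L - 3 ≤ j ∧ U j = U k := by
    intro k hk
    rcases hlast with ⟨l1, l2, l3⟩ | ⟨l1, l2, l3⟩ | ⟨l1, l2, l3⟩ <;> interval_cases k <;>
      first
      | exact ⟨L - 3, by omega, by omega, l1.trans h0.symm⟩
      | exact ⟨L - 3, by omega, by omega, l1.trans h1.symm⟩
      | exact ⟨L - 3, by omega, by omega, l1.trans h2.symm⟩
      | exact ⟨L - 2, by omega, by omega, l2.trans h0.symm⟩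
      | exact ⟨L - 2, by omega, by omega, l2.trans h1.symm⟩
      | exact ⟨L - 2, by omega, by omega, l2.trans h2.symm⟩
      | exact ⟨L - 1, by omega, by omega, l3.trans h0.symm⟩
      | exact ⟨L - 1, by omega, by omega, l3.trans h1.symm⟩
      | exact ⟨L - 1, by omega, by omega, l3.trans h2.symm⟩
  -- In a common residue class the later run would begin after the earlier letter's last use; but
  -- that letter recurs at an index `j ≥ L - 3 ≥ 2`.
  have hne : ∀ k ≤ 2, ∀ k' ≤ 2, origin d (X k) < origin d (X k') →
      origin d (X k) % 3 ≠ origin d (X k') % 3 := by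
    intro k hk k' hk' hlt heq
    obtain ⟨j, hjL, hj, hjk⟩ := hre k hk
    have hjo := (hO j hjL k (by omega)).1 hjk
    obtain ⟨s1, s2, s3⟩ := origin_spec d (X k')
    have hdvd : d ∣ origin d (X k') := s3.resolve_right (by omega)
    have hlt' : X j < origin d (X k') := by
      by_contra! hcon
      have := le_origin hdvd (by rw [← heq, ← hjo, hmod]) hcon
      omega
    have : k' ≤ j := by omega
    rcases this.eq_or_lt with rfl | h
    · omega
    · have := hX k' j h hjL
      omega
  have hdist : ∀ k ≤ 2, ∀ k' ≤ 2, U k ≠ U k' →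
      origin d (X k) % 3 ≠ origin d (X k') % 3 := by
    intro k hk k' hk' h
    rcases lt_trichotomy (origin d (X k)) (origin d (X k')) with h' | h' | h'
    · exact hne k hk k' hk' h'
    · exact absurd ((hO k (by omega) k' (by omega)).2 h') h
    · exact (hne k' hk' k hk h').symm
  have d01 := hdist 0 (by omega) 1 (by omega) (by rwa [h0, h1])
  have d12 := hdist 1 (by omega) 2 (by omega) (by rwa [h1, h2])
  have d02 := hdist 0 (by omega) 2 (by omega) (by rwa [h0, h2])
  obtain ⟨q, hq, hmax⟩ : ∃ q ≤ 2, ∀ k ≤ 2, origin d (X k) ≤ origin d (X q) := by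
    obtain ⟨q, hq, h⟩ := Finset.exists_max_image (Finset.range 3) (fun k => origin d (X k)) ⟨0, by simp⟩
    exact ⟨q, by simpa [Nat.lt_succ_iff] using hq, fun k hk => h k (by simp; omega)⟩
  set V := origin d (X q) with hV
  -- `V` is the last of the three starts. The renewal at `e` ends the run of the letter in the class
  -- of `e`, whose recurrence among the last three therefore sits at `e - 3` or earlier.
  obtain ⟨e, hde, hVe, heV⟩ : ∃ e, d ∣ e ∧ V < e ∧ e ≤ V + d := by
    have := Nat.div_add_mod' V d
    have := Nat.mod_lt V hd
    exact ⟨(V / d + 1) * d, Dvd.intro_left _ rfl, by rw [add_mul]; omega, by rw [add_mul]; omega⟩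
  obtain ⟨k, hk, hke⟩ : ∃ k ≤ 2, origin d (X k) % 3 = e % 3 := by
    by_contra! hcon
    have := hcon 0 (by omega)
    have := hcon 1 (by omega)
    have := hcon 2 (by omega)
    omega
  obtain ⟨j, hjL, hj, hjk⟩ := hre k hk
  have hjo := (hO j hjL k (by omega)).1 hjk
  have hje : X j < e := by
    by_contra! hcon
    have := le_origin hde (by rw [← hke, ← hjo, hmod]) hcon
    have := hmax k hk
    omega
  have hjm := hmod j
  have hVX : V ≤ X q := (origin_spec d (X q)).1
  have hshort : X j + 3 ≤ X q + d := by omega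
  have horig : ∀ i < L, ∀ k ≤ 2, U i = U k → X i % 3 = origin d (X k) % 3 := by
    intro i hi k hk h
    rw [← hmod, (hO i hi k (by omega)).1 h]
  -- Between indices `q ≤ 2` and `j ≥ L - 3` the occurrence spans at most `d - 3`. At most two pairs
  -- at each end are lost, all forward and of weight `w₀`.
  have hcon : ∀ w₀ w₁, (∀ i, i + 1 < L →
      X i + pairWeight a b c w₀ w₁ (U i, U (i + 1)) ≤ X (i + 1)) →
      weightSum a b c w₀ w₁ U (L - 1) + 3 ≤ d + 4 * w₀ := by
    intro w₀ w₁ h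
    have s1 := add_weightSum_le h (show q ≤ j by omega) hjL
    have s2 := weightSum_mono a b c w₀ w₁ U hq
    rw [weightSum_two h0 h1 h2] at s2
    have s3 := weightSum_mono a b c w₀ w₁ U hj
    have s4 := weightSum_add_two (w₀ := w₀) (w₁ := w₁) (j := L - 3) (U := U) (a := a) (b := b)
      (c := c) (by
        rwa [show L - 3 + 1 = L - 2 by omega, show L - 3 + 2 = L - 1 by omega])
    rw [show L - 3 + 2 = L - 1 by omega] at s4
    omega
  have hstep : ∀ w₀ w₁, (w₀ = 1 ∧ w₁ = 2 ∧ origin d (X 1) % 3 = (origin d (X 0) + 1) % 3) ∨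
      (w₀ = 2 ∧ w₁ = 1 ∧ origin d (X 1) % 3 = (origin d (X 0) + 2) % 3) →
      ∀ i, i + 1 < L → X i + pairWeight a b c w₀ w₁ (U i, U (i + 1)) ≤ X (i + 1) := by
    intro w₀ w₁ hw i hi
    have hlt := hX i (i + 1) (by omega) hi
    have r0 : ∀ i < L, U i = a → X i % 3 = origin d (X 0) % 3 := fun i hi h =>
      horig i hi 0 (by omega) (by rw [h, h0])
    have r1 : ∀ i < L, U i = b → X i % 3 = origin d (X 1) % 3 := fun i hi h =>
      horig i hi 1 (by omega) (by rw [h, h1])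
    have r2 : ∀ i < L, U i = c → X i % 3 = origin d (X 2) % 3 := fun i hi h =>
      horig i hi 2 (by omega) (by rw [h, h2])
    unfold pairWeight
    rcases hU i (by omega) with h | h | h <;> rcases hU (i + 1) hi with h' | h' | h' <;>
      simp only [h, h', List.mem_cons, Prod.mk.injEq, List.not_mem_nil, hab, hbc, hac, hab.symm,
        hbc.symm, hac.symm, and_true, and_false, or_false, or_true, if_true, if_false, and_self] <;>
      first
      | (have e1 := r0 _ (by omega) h) | (have e1 := r1 _ (by omega) h)
      | (have e1 := r2 _ (by omega) h)
    all_goals first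
      | (have e2 := r0 _ hi h') | (have e2 := r1 _ hi h') | (have e2 := r2 _ hi h')
    all_goals omega
  by_cases hori : origin d (X 1) % 3 = (origin d (X 0) + 1) % 3
  · have := hcon 1 2 (hstep 1 2 (Or.inl ⟨rfl, rfl, hori⟩))
    omega
  · have := hcon 2 1 (hstep 2 1 (Or.inr ⟨rfl, rfl, by omega⟩))
    omega

/-- The partial weight sums are the positions of the greedy embedding of `u`, the last being `d +
2`. -/
theorem inPeriodic_of_weightSum {a b c : α} (hab : a ≠ b) (hbc : b ≠ c) (hac : a ≠ c) {u : List α}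
    {d : ℕ} (hmem : ∀ x ∈ u, x = a ∨ x = b ∨ x = c) (h0 : u.getD 0 a = a)
    (h : weightSum a b c 1 2 (fun i => u.getD i a) (u.length - 1) = d + 2) :
    InPeriodic d u := by
  intro H hH
  set S := weightSum a b c 1 2 (fun i => u.getD i a) with hS
  let ρ : α → ℕ := fun x => if x = a then 0 else if x = b then 1 else 2
  have hpos : ∀ e, 0 < pairWeight a b c 1 2 e := by
    intro e
    unfold pairWeight
    split_ifs <;> omega
  have hmono : StrictMono S := strictMono_nat_of_lt_succ fun j => by
    rw [hS, weightSum_succ]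
    exact Nat.lt_add_of_pos_right (hpos _)
  have hmem' : ∀ j < u.length, u.getD j a = a ∨ u.getD j a = b ∨ u.getD j a = c := by
    intro j hj
    rw [List.getD_eq_getElem _ _ hj]
    exact hmem _ (List.getElem_mem hj)
  have hρ : ∀ j < u.length, S j % 3 = ρ (u.getD j a) := by
    intro j
    induction j with
    | zero =>
      intro _
      rw [h0]
      simp [hS, weightSum, ρ]
    | succ j ih =>
      intro hj
      have ih := ih (by omega)
      rw [hS, weightSum_succ, ← hS]
      unfold pairWeight
      simp only [ρ] at ih ⊢
      rcases hmem' j (by omega) with h | h | h <;> rcases hmem' (j + 1) hj with h' | h' | h' <;>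
        simp only [h, h', List.mem_cons, Prod.mk.injEq, List.not_mem_nil, hab, hbc, hac, hab.symm,
          hbc.symm, hac.symm, and_true, and_false, or_false, or_true, if_true, if_false, and_self] at ih ⊢ <;> omega
  rw [avoids_iff]
  push Not
  refine ⟨H ∘ ρ, ?_, ?_⟩
  · refine hH.comp ?_ ?_
    · intro x hx y hy hxy
      simp only [ρ] at hxy
      rcases hmem x hx with h | h | h <;> rcases hmem y hy with h' | h' | h' <;>
        first
        | exact h.trans h'.symm
        | (exfalso; simp [h, h', hab.symm, hbc.symm, hac.symm] at hxy)
    · intro x _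
      simp only [ρ, Set.mem_ofPred_eq]
      split_ifs <;> omega
  · have : u.map (H ∘ ρ) = ((List.range u.length).map S).map fun j => H (j % 3) := by
      apply List.ext_getElem
      · simp
      · intro j h1 _
        rw [List.length_map] at h1
        simp [hρ j h1, h1]
    rw [this]
    refine List.Sublist.map _ (sublist_range ?_ ?_)
    · rw [List.pairwise_map]
      exact List.pairwise_lt_range.imp fun h => hmono h
    · intro p hp
      obtain ⟨j, hj, rfl⟩ := List.mem_map.1 hp
      rw [List.mem_range] at hj
      have := hmono.monotone (show j ≤ u.length - 1 by omega)
      omega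

/-- A word on three letters that begins with `abc`, ends with a rotation of `abc` and has at least
four more forward than backward pairs has a linear saturation function. -/
theorem satLinear_of_forward {a b c : α} (hab : a ≠ b) (hbc : b ≠ c) (hac : a ≠ c) {u : List α}
    (hL : 5 ≤ u.length) (hmem : ∀ x ∈ u, x = a ∨ x = b ∨ x = c) (h0 : u.getD 0 a = a)
    (h1 : u.getD 1 a = b) (h2 : u.getD 2 a = c)
    (hlast : IsRotation a b c (u.getD (u.length - 3) a) (u.getD (u.length - 2) a)
      (u.getD (u.length - 1) a))
    (hf : f1 a b c u + 4 ≤ f0 a b c u) : SatLinear u := by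
  have hu : u ≠ [] := by rintro rfl; simp at hL
  have e1 := sum_pairWeight_add hab hbc hac (u.zip u.tail)
  have e2 := countP_le_sum_pairWeight a b c (u.zip u.tail)
  unfold f0 f1 countPairs at hf
  rw [sum_map_zip_tail _ a, sum_map_zip_tail _ a] at e1
  rw [sum_map_zip_tail _ a] at e2
  change weightSum a b c 2 1 (fun i => u.getD i a) (u.length - 1) + _ =
    weightSum a b c 1 2 (fun i => u.getD i a) (u.length - 1) + _ at e1
  change _ ≤ weightSum a b c 1 2 (fun i => u.getD i a) (u.length - 1) at e2
  obtain ⟨d, hd⟩ : ∃ d, weightSum a b c 1 2 (fun i => u.getD i a) (u.length - 1) = d + 2 :=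
    ⟨weightSum a b c 1 2 (fun i => u.getD i a) (u.length - 1) - 2, by omega⟩
  have hget : ∀ j, j < u.length → u.getD j a ∈ u := fun j hj => by
    rw [List.getD_eq_getElem _ _ hj]
    exact List.getElem_mem hj
  have hr : numLetters u = 3 := by
    have : u.toFinset = {a, b, c} := by
      ext x
      simp only [List.mem_toFinset, Finset.mem_insert, Finset.mem_singleton]
      refine ⟨hmem x, ?_⟩
      rintro (rfl | rfl | rfl)
      · exact h0 ▸ hget 0 (by omega)
      · exact h1 ▸ hget 1 (by omega)
      · exact h2 ▸ hget 2 (by omega)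
    rw [numLetters, this, Finset.card_eq_three]
    exact ⟨a, b, c, hab, hac, hbc, rfl⟩
  have hd2 : 2 ≤ d := by omega
  refine satLinear_of_avoids_weave hu hr hd2 (inPeriodic_of_weightSum hab hbc hac hmem h0 hd)
    fun N => ?_
  rw [avoids_iff]
  intro f hfi hs
  obtain ⟨P, hP, hPu⟩ := List.sublist_map_iff.1 hs
  have hPL : P.length = u.length := by simpa using (congrArg List.length hPu).symm
  have hPlt := List.pairwise_lt_range.sublist hP
  refine weave_occurrence_false (L := u.length) (U := fun j => u.getD j a)
    (X := fun j => P.getD j 0) (f := f) (d := d) hab hbc hac (by omega) hL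
    (fun j hj => hmem _ (hget j hj)) ?_ ?_ ?_ h0 h1 h2 hlast hd ?_
  · refine hfi.mono ?_
    rintro x (rfl | rfl | rfl)
    · exact h0 ▸ hget 0 (by omega)
    · exact h1 ▸ hget 1 (by omega)
    · exact h2 ▸ hget 2 (by omega)
  · intro i j hij hj
    rw [List.getD_eq_getElem _ _ (by omega), List.getD_eq_getElem _ _ (by omega)]
    exact List.pairwise_iff_getElem.1 hPlt i j _ _ hij
  · intro j hj
    have := congrArg (fun l => l.getD j 0) hPu
    simpa [hj, hPL] using this
  · omega

theorem satLinear_of_isForwardThreeLetter {u : List α} (h : IsForwardThreeLetter u) :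
    SatLinear u := by
  obtain ⟨a, b, c, v, w, hab, hbc, hac, rfl, hw, hv, hf⟩ := h
  have hwl : w.length = 3 := by rcases hw with rfl | rfl | rfl <;> rfl
  refine satLinear_of_forward hab hbc hac (by simp; omega) ?_ rfl rfl rfl ?_ (by omega)
  · intro x hx
    simp only [List.mem_append, List.mem_cons, List.not_mem_nil, or_false] at hx
    rcases hx with (hx | hx) | hx
    · exact hx
    · exact hv x hx
    · rcases hw with rfl | rfl | rfl <;> simp at hx <;> tauto
  · have hget : ∀ i < 3, ([a, b, c] ++ v ++ w).getD (([a, b, c] ++ v ++ w).length - 3 + i) a =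
        w.getD i a := by
      intro i _
      rw [List.getD_append_right _ _ _ _ (by simp; omega)]
      congr 1
      simp
      omega
    have hl : 3 ≤ ([a, b, c] ++ v ++ w).length := by simp
    have g0 := hget 0 (by omega)
    have g1 := hget 1 (by omega)
    have g2 := hget 2 (by omega)
    rw [show ([a, b, c] ++ v ++ w).length - 3 + 0 = ([a, b, c] ++ v ++ w).length - 3 by omega] at g0
    rw [show ([a, b, c] ++ v ++ w).length - 3 + 1 = ([a, b, c] ++ v ++ w).length - 2 by omega] at g1
    rw [show ([a, b, c] ++ v ++ w).length - 3 + 2 = ([a, b, c] ++ v ++ w).length - 1 by omega] at g2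
    rw [g0, g1, g2]
    rcases hw with rfl | rfl | rfl
    · exact Or.inl ⟨rfl, rfl, rfl⟩
    · exact Or.inr (Or.inl ⟨rfl, rfl, rfl⟩)
    · exact Or.inr (Or.inr ⟨rfl, rfl, rfl⟩)

end

/-! ### Alternations -/

/-- By sparsity a repeated letter `x` is followed by two further distinct letters before it recurs,
which gives a copy of `abca`. -/
theorem nodup_of_isSparse_of_avoids {α β : Type*} {a b c : α} (hab : a ≠ b) (hbc : b ≠ c)
    (hac : a ≠ c) {s : List β} (hs : IsSparse 3 s) (ha : Avoids s [a, b, c, a]) : s.Nodup := by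
  classical
  induction s with
  | nil => exact List.nodup_nil
  | cons x s ih =>
    rw [List.nodup_cons]
    refine ⟨fun hx => ?_, ih (hs.of_infix (List.suffix_cons x s).isInfix)
      (ha.mono (List.sublist_cons_self x s))⟩
    obtain ⟨p, q, rfl⟩ := List.append_of_mem hx
    rcases p with _ | ⟨y, _ | ⟨z, p⟩⟩
    · have := hs [x, x] ⟨[], q, by simp⟩ (by simp)
      simp at this
    · have := hs [x, y, x] ⟨[], q, by simp⟩ (by simp)
      simp at this
    · have hnd := hs [x, y, z] ⟨[], p ++ x :: q, by simp⟩ (by simp)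
      simp only [List.nodup_cons, List.mem_cons, List.not_mem_nil, or_false, not_or] at hnd
      obtain ⟨⟨hxy, hxz⟩, hyz, -⟩ := hnd
      refine avoids_iff.1 ha (fun w => if w = a then x else if w = b then y else z) ?_ ?_
      · intro v hv w hw hvw
        simp only [List.mem_cons, List.not_mem_nil, or_false, Set.mem_ofPred_eq] at hv hw
        rcases hv with h | h | h | h <;> rcases hw with h' | h' | h' | h' <;>
          first
          | exact h.trans h'.symm
          | (exfalso
             simp [h, h', hab.symm, hbc.symm, hac.symm, hxy, hxz, hyz, Ne.symm hxy, Ne.symm hxz,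
               Ne.symm hyz] at hvw)
      · simp only [List.map_cons, List.map_nil, if_true, hab.symm, hbc.symm, hac.symm, if_false]
        refine (((List.singleton_sublist.2 ?_).cons_cons z).cons_cons y).cons_cons x
        simp

section

variable {α : Type*}

theorem power_succ (w : List α) (t : ℕ) : power w (t + 1) = w ++ power w t := by
  simp [power, List.replicate_succ]

theorem length_power (w : List α) (t : ℕ) : (power w t).length = t * w.length := by
  simp [power]

theorem getD_power_append {a b c : α} {w : List α} (hw : w = [] ∨ w = [a] ∨ w = [a, b]) (t j : ℕ)
    (hj : j < (power [a, b, c] t ++ w).length) :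
    (power [a, b, c] t ++ w).getD j a = [a, b, c].getD (j % 3) a := by
  induction t generalizing j with
  | zero =>
    rcases hw with rfl | rfl | rfl <;> simp [power] at hj
    · subst hj
      rfl
    · interval_cases j <;> rfl
  | succ t ih =>
    rw [power_succ] at hj ⊢
    match j, hj with
    | 0, _ => rfl
    | 1, _ => rfl
    | 2, _ => rfl
    | j + 3, hj =>
      rw [Nat.add_mod_right, ← ih j (by simpa using hj)]
      rfl

variable [DecidableEq α]

theorem countPairs_cons_cons (P : List (α × α)) (x y : α) (l : List α) :
    countPairs P (x :: y :: l) = countPairs P (y :: l) + if (x, y) ∈ P then 1 else 0 := by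
  simp [countPairs, List.countP_cons]

/-- The extra `c` in front makes every letter of the alternation end one forward pair, so that the
induction on `t` has no boundary case. -/
theorem f0_f1_cons_power_append {a b c : α} (hab : a ≠ b) (hbc : b ≠ c) (hac : a ≠ c)
    {w : List α} (hw : w = [] ∨ w = [a] ∨ w = [a, b]) (t : ℕ) :
    f0 a b c (c :: (power [a, b, c] t ++ w)) = (power [a, b, c] t ++ w).length ∧
      f1 a b c (c :: (power [a, b, c] t ++ w)) = 0 := by
  induction t with
  | zero =>
    rcases hw with rfl | rfl | rfl <;>
      simp [power, f0, f1, countPairs, hab, hbc, hac, hab.symm, hbc.symm,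
        hac.symm]
  | succ t ih =>
    rw [power_succ]
    unfold f0 f1 at ih ⊢
    simp only [List.cons_append, List.nil_append, countPairs_cons_cons, ih.1, ih.2,
      List.length_cons]
    simp [hab, hbc, hac, hab.symm, hbc.symm, hac.symm]

theorem satLinear_of_isAlternation {u : List α} (h : IsAlternation u) : SatLinear u := by
  obtain ⟨a, b, c, t, hab, hbc, hac, ht, hu⟩ := h
  obtain ⟨w, hw, rfl⟩ : ∃ w, (w = [] ∨ w = [a] ∨ w = [a, b]) ∧ u = power [a, b, c] t ++ w := by
    rcases hu with rfl | rfl | rfl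
    · exact ⟨[], by simp, by simp⟩
    · exact ⟨[a], by simp, rfl⟩
    · exact ⟨[a, b], by simp, rfl⟩
  obtain ⟨t, rfl⟩ : ∃ t', t = t' + 1 := ⟨t - 1, by omega⟩
  -- All pairs are forward, so `f0 - f1` is the length minus one, which is at least four exactly
  -- from length five on.
  rcases le_or_gt 5 (power [a, b, c] (t + 1) ++ w).length with hL | hL
  · have hget := getD_power_append (c := c) hw (t + 1)
    refine satLinear_of_forward hab hbc hac hL ?_ rfl rfl rfl ?_ ?_
    · intro x hx
      rcases List.mem_append.1 hx with hx | hx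
      · obtain ⟨l, hl, hx⟩ := List.mem_flatten.1 hx
        rw [List.eq_of_mem_replicate hl] at hx
        simpa using hx
      · rcases hw with rfl | rfl | rfl <;> simp at hx <;> tauto
    · set L := (power [a, b, c] (t + 1) ++ w).length
      rw [hget (L - 3) (by omega), hget (L - 2) (by omega), hget (L - 1) (by omega)]
      have : (L - 2) % 3 = ((L - 3) % 3 + 1) % 3 := by omega
      have : (L - 1) % 3 = ((L - 3) % 3 + 2) % 3 := by omega
      have : (L - 3) % 3 < 3 := Nat.mod_lt _ (by omega)
      rw [‹(L - 2) % 3 = _›, ‹(L - 1) % 3 = _›]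
      interval_cases (L - 3) % 3
      · exact Or.inl ⟨rfl, rfl, rfl⟩
      · exact Or.inr (Or.inl ⟨rfl, rfl, rfl⟩)
      · exact Or.inr (Or.inr ⟨rfl, rfl, rfl⟩)
    · obtain ⟨h0, h1⟩ := f0_f1_cons_power_append hab hbc hac hw t
      rw [power_succ] at hL ⊢
      unfold f0 at h0 ⊢
      unfold f1 at h1 ⊢
      simp only [List.cons_append, List.nil_append, countPairs_cons_cons, h0, h1,
        List.length_cons] at hL ⊢
      simp [hab, hbc, hac, hab.symm, hbc.symm, hac.symm]
      simp at hL
      omega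
  · have ht : t = 0 := by
      rw [List.length_append, length_power] at hL
      simp at hL
      omega
    subst ht
    have hpow : power [a, b, c] (0 + 1) = [a, b, c] := by simp [power]
    rw [hpow] at hL ⊢
    have hsub : ([a, b, c] ++ w).Sublist [a, b, c, a] := by
      rcases hw with rfl | rfl | rfl
      · simp
      · exact List.Sublist.refl _
      · simp at hL
    refine satLinear_of_length_le (by simp) fun n s hs ha => ?_
    have hr : numLetters ([a, b, c] ++ w) = 3 := by
      have : ([a, b, c] ++ w).toFinset = {a, b, c} := by
        rcases hw with rfl | rfl | rfl <;> ext x <;> simp <;> tauto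
      rw [numLetters, this, Finset.card_eq_three]
      exact ⟨a, b, c, hab, hac, hbc, rfl⟩
    rw [hr] at hs
    have hnd : s.Nodup := by
      refine nodup_of_isSparse_of_avoids hab hbc hac hs (avoids_iff.2 fun f hf h => ?_)
      refine avoids_iff.1 ha f (hf.mono fun x hx => hsub.subset hx) ((hsub.map f).trans h)
    simpa using hnd.length_le_card

end

end SeqSat

theorem theorem1p2 {α : Type*} [DecidableEq α] (u : List α) :
    (SeqSat.IsAlternation u → SeqSat.SatLinear u) ∧
    (SeqSat.IsDoubleEnded u → SeqSat.Irreducible u → SeqSat.SatLinear u) ∧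
    (SeqSat.IsForwardThreeLetter u → SeqSat.SatLinear u) :=
  ⟨SeqSat.satLinear_of_isAlternation, SeqSat.satLinear_of_isDoubleEnded,
    SeqSat.satLinear_of_isForwardThreeLetter⟩
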